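/- All graphs are finite and simple. For a graph $G$, let $\mathcal I(G)$ be the family of independent sets of $G$. A fractional colouring of $G$ is a map $f:\mathcal I(G)\to[0,1]$ with $\sum_{I\in\mathcal I(G),\,v\in I} f(I)\ge 1$ for every vertex $v$; its weight is $\sum_{I\in\mathcal I(G)} f(I)$, and the fractional chromatic number $\chi_f(G)$ is the minimum weight of a fractional colouring of $G$. For an integer $n\ge 1$, the $n$th cone $\Delta_n(G)$ is the graph with vertex set $(V(G)\times\{0,1,\dots,n-1\})\cup\{\star\}$ and edge set $\{(x,i)(y,j): xy\in E(G),\ |i-j|=1 \text{ or } i=j=0\}\cup\{(x,n-1)\star : x\in V(G)\}$. For a graph $H$ with at least one vertex and a map $h$ from $V(H)$ to the positive integers, the $(H,h)$-cone $\Delta_{H,h}(G)$ is obtained from the disjoint union of copies $\Delta_{h(v)}(G)\times\{v\}$, $v\in V(H)$, of the cones $\Delta_{h(v)}(G)$ by identifying, for each $x\in V(G)$, the vertices $((x,0),v)$, $v\in V(H)$, into a single vertex, and adding the edges $(\star,v)(\star,v')$ for $vv'\in E(H)$. **Theorem.** Let $G$ be a graph with at least one edge, let $v_1,v_2$ be the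 vertices of the complete graph $K_2$, and let $h$ be a map from $V(K_2)$ to the positive integers with $h(v_2)\ge h(v_1)=n$, where, in the constant case $h(v_1)=h(v_2)=n$, the integer $n$ is assumed to be even. Then $$\chi_f(\Delta_{K_2,h}(G))=\chi_f(\Delta_n(G)).$$ -/

import Mathlib

namespace GeneralizedCone

/-- The family `𝓘(G)` of independent sets of a graph `G` on a finite vertex set. -/
abbrev IndepFamily {V : Type*} (G : SimpleGraph V) : Type _ :=
  {I : Finset V // G.IsIndepSet (I : Set V)}

open Classical in
/-- `f : 𝓘(G) → [0,1]` is a fractional colouring of `G`: for every vertex `v`, the values of `f`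
on the independent sets that contain `v` add up to at least `1`. -/
def IsFractionalColouring {V : Type*} [Fintype V] (G : SimpleGraph V)
    (f : IndepFamily G → ℝ) : Prop :=
  (∀ I, f I ∈ Set.Icc (0 : ℝ) 1) ∧
    ∀ v : V, 1 ≤ ∑ I : IndepFamily G, if v ∈ I.1 then f I else 0

open Classical in
/-- The weight of a real function on the independent sets of `G`. -/
noncomputable def weight {V : Type*} [Fintype V] (G : SimpleGraph V)
    (f : IndepFamily G → ℝ) : ℝ :=
  ∑ I : IndepFamily G, f I

/-- The fractional chromatic number `χ_f(G)` of a finite graph: the minimum weight of a fractional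
colouring. It is written as an infimum, which is attained, see `fracChromatic_isLeast`. -/
noncomputable def fracChromatic {V : Type*} [Fintype V] (G : SimpleGraph V) : ℝ :=
  sInf (weight G '' {f | IsFractionalColouring G f})

theorem fracChromatic_isLeast {V : Type*} [Fintype V] (G : SimpleGraph V) :
    IsLeast (weight G '' {f | IsFractionalColouring G f}) (fracChromatic G) := by
  classical
  have hcomp : IsCompact {f | IsFractionalColouring G f} := by
    have hbox : IsCompact (Set.univ.pi fun _ : IndepFamily G => Set.Icc (0 : ℝ) 1) :=
      isCompact_univ_pi fun _ => isCompact_Icc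
    refine hbox.of_isClosed_subset ?_ fun f hf I _ => hf.1 I
    have hset : {f | IsFractionalColouring G f} =
        (⋂ I : IndepFamily G, {f | f I ∈ Set.Icc (0 : ℝ) 1}) ∩
          ⋂ v : V, {f | 1 ≤ ∑ I : IndepFamily G, if v ∈ I.1 then f I else 0} := by
      ext f
      simp only [Set.mem_inter_iff, Set.mem_iInter]
      exact Iff.rfl
    rw [hset]
    refine (isClosed_iInter fun I => isClosed_Icc.preimage (continuous_apply I)).inter
      (isClosed_iInter fun v => isClosed_le continuous_const
        (continuous_finsetSum _ fun I _ => ?_))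
    split_ifs
    · exact continuous_apply I
    · exact continuous_const
  have hne : {f | IsFractionalColouring G f}.Nonempty := by
    refine ⟨fun _ => 1, fun _ => by simp, fun v => ?_⟩
    have hv : G.IsIndepSet (({v} : Finset V) : Set V) := by simp [SimpleGraph.IsIndepSet]
    have := Finset.single_le_sum (s := Finset.univ)
      (f := fun I : IndepFamily G => if v ∈ I.1 then (1 : ℝ) else 0)
      (fun I _ => by split_ifs <;> norm_num) (Finset.mem_univ ⟨{v}, hv⟩)
    simpa using this
  have hcont : Continuous (weight G) :=
    continuous_finsetSum _ fun I _ => continuous_apply I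
  exact (hcomp.image hcont).isLeast_sInf (hne.image _)

/-- Vertices of the `n`-th cone over a graph on `V`: `some (x, i)` is `(x, i)`, in layer `i`,
and `none` is the apex `⋆`. -/
abbrev ConeVertex (V : Type*) (n : ℕ) : Type _ := Option (V × Fin n)

/-- The adjacency of the `n`-th cone: `(x, i)` and `(y, j)` are adjacent when `xy` is an edge and
`|i - j| = 1` or `i = j = 0`; the apex is adjacent exactly to the layer `n - 1`. -/
def ConeAdj {V : Type*} (G : SimpleGraph V) (n : ℕ) : ConeVertex V n → ConeVertex V n → Prop
  | some (x, i), some (y, j) =>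
      G.Adj x y ∧ (i.val + 1 = j.val ∨ j.val + 1 = i.val ∨ (i.val = 0 ∧ j.val = 0))
  | some (_, i), none => i.val + 1 = n
  | none, some (_, j) => j.val + 1 = n
  | none, none => False

/-- The `n`-th cone `Δ_n(G)` over `G` (for `n ≥ 1`). -/
def cone {V : Type*} (G : SimpleGraph V) (n : ℕ) : SimpleGraph (ConeVertex V n) where
  Adj := ConeAdj G n
  symm := ⟨by
    rintro (_ | ⟨x, i⟩) (_ | ⟨y, j⟩) h
    · exact h
    · exact h
    · exact h
    · exact ⟨h.1.symm, by have := h.2; tauto⟩⟩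
  loopless := ⟨by
    rintro (_ | ⟨x, i⟩) h
    · exact h
    · exact G.loopless.irrefl x h.1⟩

/-- Vertices of the `(H, h)`-cone over a graph on `V`, where `H` has vertex set `W`: the common
base (a copy of `V`), for every `v : W` the layers `1, …, h v - 1` of the copy of `Δ_{h v}(G)`
that belongs to `v`, and for every `v : W` an apex `(⋆, v)`. -/
abbrev HConeVertex (V : Type*) {W : Type*} (h : W → ℕ) : Type _ :=
  V ⊕ (Σ v : W, V × Fin (h v - 1)) ⊕ W

/-- The vertex of the `(H, h)`-cone that a vertex of the copy of `Δ_{h v}(G)` belonging to `v`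
becomes when the bases of all the copies are identified. -/
def glue {V W : Type*} (h : W → ℕ) (v : W) : ConeVertex V (h v) → HConeVertex V h
  | none => Sum.inr (Sum.inr v)
  | some (x, ⟨0, _⟩) => Sum.inl x
  | some (x, ⟨i + 1, hi⟩) => Sum.inr (Sum.inl ⟨v, x, ⟨i, Nat.lt_sub_of_add_lt hi⟩⟩)

/-- The `(H, h)`-cone `Δ_{H,h}(G)` over `G` (for `H` with at least one vertex and `h ≥ 1`): the
edges are those of the copies of the cones `Δ_{h v}(G)`, and the edges of `H` between apexes. -/
def hCone {V W : Type*} (G : SimpleGraph V) (H : SimpleGraph W) (h : W → ℕ) :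
    SimpleGraph (HConeVertex V h) where
  Adj a b :=
    (∃ (v : W) (p q : ConeVertex V (h v)),
      (cone G (h v)).Adj p q ∧ glue h v p = a ∧ glue h v q = b) ∨
    (∃ v v' : W, H.Adj v v' ∧ glue h v none = a ∧ glue h v' none = b)
  symm := ⟨by
    rintro a b (⟨v, p, q, hpq, rfl, rfl⟩ | ⟨v, v', hv, rfl, rfl⟩)
    · exact Or.inl ⟨v, q, p, hpq.symm, rfl, rfl⟩
    · exact Or.inr ⟨v', v, hv.symm, rfl, rfl⟩⟩
  loopless := ⟨by
    rintro a (⟨v, p, q, hpq, rfl, hq⟩ | ⟨v, v', hv, rfl, hv'⟩)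
    · have : q = p := by
        rcases p with _ | ⟨x, ⟨_ | i, hi⟩⟩ <;> rcases q with _ | ⟨y, ⟨_ | j, hj⟩⟩ <;>
          simp_all [glue]
      subst this
      exact (cone G (h v)).loopless.irrefl _ hpq
    · have : v' = v := by simpa [glue] using hv'
      subst this
      exact H.loopless.irrefl _ hv⟩

end GeneralizedCone

/-! The inequality ≥ is monotonicity of χ_f under the homomorphism placing Δ_n(G) in the double
cone. For ≤ there are two mechanisms.

If the second arm is longer, an optimal colouring of Δ_n(G) extends
(`fracChromatic_hCone_le_cone_of_lt`): the base is repeated to absorb extra length, the apex is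
turned into one more layer, full on sets of total weight 1 containing the old apex. The second apex
goes into all other sets, of total weight χ_f - 1 ≥ 1 because there is an edge.

If both arms have height n = 2M, no such room is left. Put s = χ_f(G) - 1 and σ = 1 + s + ... +
s^(n-1); the value χ_f(G) + 1/σ separates the two sides. It bounds χ_f(Δ_n(G)) from below, by
converting a colouring of the cone into one of G that saves 1/σ (`fracChromatic_add_inv_le_cone`).
It bounds the double cone from above by an explicit colouring (`fracChromatic_hCone_le_add_inv`),
geometrically weighted on each arm and coupled so that no set contains both apexes. Evenness of n
attaches the apexes to odd levels, away from the level-0 set, which the two arms share. -/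

namespace GeneralizedCone

/-! ### Weighted covers by independent sets -/

open Classical in
/-- A finite weighted family of independent sets that covers every vertex with total weight at
least `1` bounds the fractional chromatic number by its total weight. -/
theorem fracChromatic_le_of_cover {V ι : Type*} [Fintype V] [Fintype ι] (G : SimpleGraph V)
    (K : ι → Set V) (hK : ∀ i, G.IsIndepSet (K i)) (c : ι → ℝ) (hc : ∀ i, 0 ≤ c i)
    (hcov : ∀ v, 1 ≤ ∑ i, if v ∈ K i then c i else 0) :
    fracChromatic G ≤ ∑ i, c i := by
  let L : ι → IndepFamily G := fun i => ⟨(K i).toFinset, by simpa using hK i⟩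
  have hL : ∀ i v, v ∈ (L i).1 ↔ v ∈ K i := fun i v => by simp [L]
  let g : IndepFamily G → ℝ := fun I => ∑ i, if L i = I then c i else 0
  have hg : ∀ I, 0 ≤ g I := fun I =>
    Finset.sum_nonneg fun i _ => by split_ifs <;> simp [hc]
  -- Several indices may give the same set, so the merged weight can exceed 1 and is truncated.
  -- Truncation is harmless: one set of weight 1 already covers its vertices.
  have hf : IsFractionalColouring G fun I => min 1 (g I) := by
    refine ⟨fun I => ⟨le_min zero_le_one (hg I), min_le_left _ _⟩, fun v => ?_⟩
    by_cases hbig : ∃ I : IndepFamily G, v ∈ I.1 ∧ 1 ≤ g I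
    · obtain ⟨I, hvI, hI⟩ := hbig
      have := Finset.single_le_sum (s := Finset.univ)
        (f := fun I : IndepFamily G => if v ∈ I.1 then min 1 (g I) else 0)
        (fun I _ => by split_ifs <;> simp [hg]) (Finset.mem_univ I)
      simpa [hvI, hI] using this
    · push Not at hbig
      calc (1 : ℝ) ≤ ∑ i, if v ∈ K i then c i else 0 := hcov v
        _ = ∑ I : IndepFamily G, if v ∈ I.1 then g I else 0 := by
            simp only [g]
            have : ∀ I : IndepFamily G,
                (if v ∈ I.1 then (∑ i, if L i = I then c i else 0) else (0 : ℝ)) =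
                  ∑ i, if L i = I then (if v ∈ K i then c i else 0) else 0 := by
              intro I
              by_cases hv : v ∈ I.1
              · rw [if_pos hv]
                refine Finset.sum_congr rfl fun i _ => ?_
                by_cases h : L i = I
                · rw [if_pos h, if_pos h, if_pos ((hL i v).1 (h ▸ hv))]
                · rw [if_neg h, if_neg h]
              · rw [if_neg hv]
                refine (Finset.sum_eq_zero fun i _ => ?_).symm
                by_cases h : L i = I
                · rw [if_pos h, if_neg fun h' => hv (h ▸ (hL i v).2 h')]
                · rw [if_neg h]
            rw [Finset.sum_congr rfl fun I _ => this I, Finset.sum_comm]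
            simp
        _ ≤ _ := Finset.sum_le_sum fun I _ => by
            split_ifs with h
            · exact le_min (hbig I h).le le_rfl
            · exact le_rfl
  refine ((fracChromatic_isLeast G).2 ⟨_, hf, rfl⟩).trans ?_
  calc weight G (fun I => min 1 (g I)) ≤ ∑ I, g I :=
        Finset.sum_le_sum fun I _ => min_le_right _ _
    _ = ∑ i, c i := by
        simp only [g]
        rw [Finset.sum_comm]
        simp

universe u

open Classical in
theorem exists_optimal_cover {V : Type u} [Fintype V] (G : SimpleGraph V) :
    ∃ (ι : Type u) (_ : Fintype ι) (K : ι → Set V) (f : ι → ℝ),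
      (∀ i, G.IsIndepSet (K i)) ∧ (∀ i, 0 ≤ f i) ∧ ∑ i, f i = fracChromatic G ∧
      ∀ v, 1 ≤ ∑ i, if v ∈ K i then f i else 0 := by
  obtain ⟨f, hf, hw⟩ := (fracChromatic_isLeast G).1
  refine ⟨IndepFamily G, inferInstance, fun I => (I.1 : Set V), f, fun I => I.2,
    fun I => (hf.1 I).1, hw, fun v => ?_⟩
  convert hf.2 v using 3
  exact Finset.mem_coe

theorem fracChromatic_le_of_hom {V W : Type*} [Fintype V] [Fintype W] {G : SimpleGraph V}
    {H : SimpleGraph W} (φ : G →g H) : fracChromatic G ≤ fracChromatic H := by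
  obtain ⟨ι, _, K, f, hK, hf, hw, hcov⟩ := exists_optimal_cover H
  rw [← hw]
  refine fracChromatic_le_of_cover G (fun i => φ ⁻¹' K i) ?_ f hf fun v => hcov (φ v)
  intro i x hx y hy _ hxy
  exact hK i hx hy (φ.map_adj hxy).ne (φ.map_adj hxy)

theorem two_le_fracChromatic {V : Type*} [Fintype V] {G : SimpleGraph V} {x y : V}
    (hxy : G.Adj x y) : 2 ≤ fracChromatic G := by
  classical
  obtain ⟨ι, _, K, f, hK, hf, hw, hcov⟩ := exists_optimal_cover G
  have h : (∑ i, if x ∈ K i then f i else 0) + (∑ i, if y ∈ K i then f i else 0) ≤ ∑ i, f i := by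
    rw [← Finset.sum_add_distrib]
    refine Finset.sum_le_sum fun i _ => ?_
    by_cases hx : x ∈ K i
    · have hy : y ∉ K i := fun hy => hK i hx hy hxy.ne hxy
      simp [hx, hy]
    · simp only [hx, if_false, zero_add]
      split_ifs <;> simp [hf]
  have h1 := hcov x
  have h2 := hcov y
  linarith

/-! ### Independent sets of generalized cones, layer by layer -/

/-- The map `glue` is a homomorphism from the cone belonging to `v` to the `(H, h)`-cone. -/
def glueHom {V W : Type*} (G : SimpleGraph V) (H : SimpleGraph W) (h : W → ℕ) (v : W) :
    cone G (h v) →g hCone G H h where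
  toFun := glue h v
  map_rel' hpq := Or.inl ⟨v, _, _, hpq, rfl, rfl⟩

/-- The set of vertices of an `(H, h)`-cone with base `B`, layers `S v i` for `1 ≤ i < h v` and
the apexes of those `v` for which `T v` holds. -/
def layeredSet {V W : Type*} (h : W → ℕ) (B : Set V) (S : W → ℕ → Set V) (T : W → Prop) :
    Set (HConeVertex V h) :=
  {a | match a with
    | Sum.inl x => x ∈ B
    | Sum.inr (Sum.inl ⟨v, x, i⟩) => x ∈ S v (i.val + 1)
    | Sum.inr (Sum.inr v) => T v}

theorem glue_some_mem_layeredSet {V W : Type*} {h : W → ℕ} {B : Set V} {S : W → ℕ → Set V}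
    {T : W → Prop} (hB : ∀ v, S v 0 = B) (v : W) (x : V) (i : Fin (h v)) :
    glue h v (some (x, i)) ∈ layeredSet h B S T ↔ x ∈ S v i := by
  rcases i with ⟨_ | i, hi⟩
  · simp [glue, layeredSet, hB]
  · simp [glue, layeredSet]

theorem isIndepSet_layeredSet {V W : Type*} (G : SimpleGraph V) (H : SimpleGraph W) {h : W → ℕ}
    {B : Set V} {S : W → ℕ → Set V} {T : W → Prop} (hB : ∀ v, S v 0 = B)
    (base : ∀ x ∈ B, ∀ y ∈ B, ¬ G.Adj x y)
    (step : ∀ v i, i + 1 < h v → ∀ x ∈ S v i, ∀ y ∈ S v (i + 1), ¬ G.Adj x y)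
    (top : ∀ v, T v → ∀ i, i + 1 = h v → ∀ x, x ∉ S v i)
    (apex : ∀ v v', H.Adj v v' → T v → ¬ T v') :
    (hCone G H h).IsIndepSet (layeredSet h B S T) := by
  rintro a ha b hb - (⟨v, p, q, hpq, rfl, rfl⟩ | ⟨v, v', hv, rfl, rfl⟩)
  · rcases p with _ | ⟨x, i⟩ <;> rcases q with _ | ⟨y, j⟩
    · exact hpq
    · exact top v ha j hpq y ((glue_some_mem_layeredSet hB v y j).1 hb)
    · exact top v hb i hpq x ((glue_some_mem_layeredSet hB v x i).1 ha)
    · rw [glue_some_mem_layeredSet hB] at ha hb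
      obtain ⟨hxy, hij | hij | ⟨hi, hj⟩⟩ := hpq
      · exact step v i (hij ▸ j.2) x ha y (hij ▸ hb) hxy
      · exact step v j (hij ▸ i.2) y hb x (hij ▸ ha) hxy.symm
      · rw [hi, hB] at ha
        rw [hj, hB] at hb
        exact base x ha y hb hxy
  · exact apex v v' hv ha hb

open Classical in
theorem fracChromatic_hCone_le {V W ι : Type*} [Fintype V] [Fintype W] [Nonempty W] [Fintype ι]
    (G : SimpleGraph V) (H : SimpleGraph W) {h : W → ℕ} (hpos : ∀ v, 0 < h v)
    (B : ι → Set V) (S : ι → W → ℕ → Set V) (T : ι → W → Prop) (c : ι → ℝ)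
    (hc : ∀ t, 0 ≤ c t) (hB : ∀ t v, S t v 0 = B t)
    (base : ∀ t, ∀ x ∈ B t, ∀ y ∈ B t, ¬ G.Adj x y)
    (step : ∀ t v i, i + 1 < h v → ∀ x ∈ S t v i, ∀ y ∈ S t v (i + 1), ¬ G.Adj x y)
    (top : ∀ t v, T t v → ∀ i, i + 1 = h v → ∀ x, x ∉ S t v i)
    (apex : ∀ t v v', H.Adj v v' → T t v → ¬ T t v')
    (cov_layer : ∀ v i x, i < h v → 1 ≤ ∑ t, if x ∈ S t v i then c t else 0)
    (cov_apex : ∀ v, 1 ≤ ∑ t, if T t v then c t else 0) :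
    fracChromatic (hCone G H h) ≤ ∑ t, c t := by
  refine fracChromatic_le_of_cover _ (fun t => layeredSet h (B t) (S t) (T t))
    (fun t => isIndepSet_layeredSet G H (hB t) (base t) (step t) (top t) (apex t)) c hc ?_
  rintro (x | ⟨v, x, i⟩ | v)
  -- A base vertex lies in layer 0 of every arm, so any one arm gives its covering inequality.
  · obtain ⟨v⟩ := ‹Nonempty W›
    have := cov_layer v 0 x (hpos v)
    simp only [hB] at this
    exact this
  · exact cov_layer v (i.val + 1) x (by omega)
  · exact cov_apex v

/-! ### Arms of different heights -/

/-- The `i`-th layer of a set of vertices of the `n`-th cone. -/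
def layer {V : Type*} {n : ℕ} (J : Set (ConeVertex V n)) (i : ℕ) : Set V :=
  {x | ∃ hi : i < n, some (x, ⟨i, hi⟩) ∈ J}

theorem mem_layer_iff {V : Type*} {n : ℕ} {J : Set (ConeVertex V n)} {i : ℕ} (hi : i < n)
    {x : V} : x ∈ layer J i ↔ some (x, ⟨i, hi⟩) ∈ J :=
  ⟨fun h => h.2, fun h => ⟨hi, h⟩⟩

theorem not_mem_layer {V : Type*} {n : ℕ} {J : Set (ConeVertex V n)} {i : ℕ} (hi : n ≤ i)
    {x : V} : x ∉ layer J i :=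
  fun h => absurd h.1 hi.not_gt

theorem not_adj_of_mem_layer_zero {V : Type*} {G : SimpleGraph V} {n : ℕ}
    {J : Set (ConeVertex V n)} (hJ : (cone G n).IsIndepSet J) {x y : V} (hx : x ∈ layer J 0) (hy : y ∈ layer J 0) :
    ¬ G.Adj x y := fun hxy => by
  have hadj : (cone G n).Adj (some (x, ⟨0, hx.1⟩)) (some (y, ⟨0, hy.1⟩)) :=
    ⟨hxy, Or.inr (Or.inr ⟨rfl, rfl⟩)⟩
  exact hJ hx.2 hy.2 hadj.ne hadj

theorem not_adj_of_mem_layer_succ {V : Type*} {G : SimpleGraph V} {n : ℕ}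
    {J : Set (ConeVertex V n)} (hJ : (cone G n).IsIndepSet J) {i : ℕ} {x y : V} (hx : x ∈ layer J i)
    (hy : y ∈ layer J (i + 1)) : ¬ G.Adj x y := fun hxy => by
  have hadj : (cone G n).Adj (some (x, ⟨i, hx.1⟩)) (some (y, ⟨i + 1, hy.1⟩)) :=
    ⟨hxy, Or.inl rfl⟩
  exact hJ hx.2 hy.2 hadj.ne hadj

theorem not_mem_layer_of_apex_mem {V : Type*} {G : SimpleGraph V} {n : ℕ}
    {J : Set (ConeVertex V n)} (hJ : (cone G n).IsIndepSet J) (hs : none ∈ J) {i : ℕ} (hi : i + 1 = n) {x : V} :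
    x ∉ layer J i := fun hx => by
  have hadj : (cone G n).Adj (some (x, ⟨i, hx.1⟩)) none := hi
  exact hJ hx.2 hs hadj.ne hadj

/-- The layers of a set of vertices of the `n`-th cone, continued by a layer `n` that is full when
`t` holds and empty otherwise. -/
def extendedLayer {V : Type*} {n : ℕ} (J : Set (ConeVertex V n)) (t : Prop) (i : ℕ) : Set V :=
  {x | x ∈ layer J i ∨ (n ≤ i ∧ t)}

/-- The added layer is nonempty only if the apex is in `J`, and then layer `n - 1` is empty. -/
theorem not_adj_of_mem_extendedLayer_succ {V : Type*} {G : SimpleGraph V} {n : ℕ}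
    {J : Set (ConeVertex V n)} (hJ : (cone G n).IsIndepSet J) {t : Prop} (ht : t → none ∈ J) {i : ℕ} (hi : i < n) {x y : V}
    (hx : x ∈ extendedLayer J t i) (hy : y ∈ extendedLayer J t (i + 1)) : ¬ G.Adj x y := by
  have hx' : x ∈ layer J i := hx.resolve_right fun h => by omega
  rcases hy with hy | ⟨hn, h⟩
  · exact not_adj_of_mem_layer_succ hJ hx' hy
  · exact absurd hx' (not_mem_layer_of_apex_mem hJ (ht h) (by omega))

theorem fracChromatic_hCone_le_cone_of_lt {V : Type*} [Fintype V] (G : SimpleGraph V)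
    (hG : ∃ x y : V, G.Adj x y) (H : SimpleGraph (Fin 2)) {n : ℕ} (hn : 1 ≤ n) (h : Fin 2 → ℕ)
    (h0 : h 0 = n) (h1 : n < h 1) :
    fracChromatic (hCone G H h) ≤ fracChromatic (cone G n) := by
  classical
  obtain ⟨ι, _, K, f, hK, hf, hw, hcov⟩ := exists_optimal_cover (cone G n)
  have htwo : 2 ≤ fracChromatic (cone G n) := by
    obtain ⟨x, y, hxy⟩ := hG
    exact two_le_fracChromatic (x := some (x, ⟨0, hn⟩)) (y := some (y, ⟨0, hn⟩))
      ⟨hxy, Or.inr (Or.inr ⟨rfl, rfl⟩)⟩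
  set C : ℝ := ∑ J, if none ∈ K J then f J else 0 with hC
  have hC1 : 1 ≤ C := hcov none
  have hC0 : 0 < C := by linarith
  -- Each set splits into a part of weight `g` and the rest. Scaling by `C` makes the apex parts
  -- total exactly 1: enough for the first apex and the full layer, and at least 1 remains for the
  -- second apex.
  let g : ι → ℝ := fun J => if none ∈ K J then f J / C else 0
  have hg : ∀ J, 0 ≤ g J := fun J => by
    simp only [g]; split_ifs
    · exact div_nonneg (hf J) hC0.le
    · exact le_rfl
  have hgf : ∀ J, g J ≤ f J := fun J => by
    simp only [g]; split_ifs
    · exact div_le_self (hf J) hC1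
    · exact hf J
  have hgsum : ∑ J, g J = 1 := by
    have : ∀ J, g J = (if none ∈ K J then f J else 0) / C := fun J => by
      simp only [g]; split_ifs <;> simp
    rw [Finset.sum_congr rfl fun J _ => this J, ← Finset.sum_div, ← hC, div_self hC0.ne']
  let t : ι × Bool → Prop := fun p => none ∈ (K p.1) ∧ p.2 = true
  -- On the long arm, truncated subtraction repeats level 0 and sends the last layer `h 1 - 1` to
  -- level `n`.
  let lev : Fin 2 → ℕ → ℕ := fun v i => if v = 0 then i else i - (h 1 - 1 - n)
  let c : ι × Bool → ℝ := fun p => if p.2 then g p.1 else f p.1 - g p.1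
  have hct : ∑ p, (if t p then c p else 0) = 1 := by
    rw [Fintype.sum_prod_type, ← hgsum]
    refine Finset.sum_congr rfl fun J _ => ?_
    by_cases hJ : none ∈ K J <;> simp [t, c, g, hJ]
  have hsum : ∑ p, c p = fracChromatic (cone G n) := by
    rw [Fintype.sum_prod_type, ← hw]
    refine Finset.sum_congr rfl fun J _ => ?_
    simp [c]
  have hcond : ∀ v i, i < h v → lev v i < n ∨ lev v i = n := by
    intro v i hi
    fin_cases v
    · simp [lev] at hi ⊢; omega
    · simp [lev] at hi ⊢; omega
  rw [← hsum]
  refine fracChromatic_hCone_le G H ?_ (fun p => layer (K p.1) 0)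
    (fun p v i => extendedLayer (K p.1) (t p) (lev v i))
    (fun p v => if v = 0 then t p else ¬ t p) c ?_ ?_ ?_ ?_ ?_ ?_ ?_ ?_
  · intro v; fin_cases v
    · simp; omega
    · simp; omega
  · rintro ⟨J, _ | _⟩
    · simpa [c] using hgf J
    · simpa [c] using hg J
  · intro p v
    have : lev v 0 = 0 := by simp [lev]
    ext x
    simp only [this, extendedLayer, Set.mem_ofPred_eq]
    exact ⟨fun hx => hx.resolve_right fun h => by omega, Or.inl⟩
  · intro p x hx y hy
    exact not_adj_of_mem_layer_zero (hK p.1) hx hy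
  · intro p v i hi x hx y hy
    have hlt : (lev v (i + 1) = lev v i + 1 ∧ lev v i < n) ∨
        (lev v (i + 1) = 0 ∧ lev v i = 0) := by
      fin_cases v
      · simp [lev] at hi ⊢; omega
      · simp [lev] at hi ⊢; omega
    rcases hlt with ⟨h2, h3⟩ | ⟨h2, h3⟩
    · rw [h2] at hy
      exact not_adj_of_mem_extendedLayer_succ (hK p.1) (fun ht => ht.1) h3 hx hy
    · rw [h2] at hy
      rw [h3] at hx
      exact not_adj_of_mem_layer_zero (hK p.1) (hx.resolve_right fun h => by omega)
        (hy.resolve_right fun h => by omega)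
  · intro p v hT i hi x hx
    fin_cases v
    · simp only [lev, Fin.zero_eta, if_true] at hT hx hi
      exact not_mem_layer_of_apex_mem (hK p.1) hT.1 (hi.trans h0)
        (hx.resolve_right fun h => by omega)
    · have hl : lev 1 i = n := by simp [lev] at hi ⊢; omega
      simp only [Fin.mk_one, Fin.isValue, one_ne_zero, if_false] at hT hx
      rw [hl] at hx
      rcases hx with hx | hx
      · exact not_mem_layer le_rfl hx
      · exact hT hx.2
  · intro p v v' hv
    have := hv.ne
    fin_cases v <;> fin_cases v' <;> simp_all
  · intro v i x hi
    rcases hcond v i hi with hl | hl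
    · refine (hcov (some (x, ⟨lev v i, hl⟩))).trans_eq ?_
      rw [Fintype.sum_prod_type]
      refine Finset.sum_congr rfl fun J _ => ?_
      have : ∀ q : Prop, x ∈ extendedLayer (K J) q (lev v i) ↔ some (x, ⟨lev v i, hl⟩) ∈ (K J) :=
        fun q => ⟨fun hx => (hx.resolve_right fun h => by omega).2, fun hx => Or.inl ⟨hl, hx⟩⟩
      simp only [this, Fintype.sum_bool, c]
      by_cases hx : some (x, ⟨lev v i, hl⟩) ∈ K J <;> simp [hx]
    · refine hct.symm.le.trans_eq (Finset.sum_congr rfl fun p _ => ?_)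
      have : x ∈ extendedLayer (K p.1) (t p) (lev v i) ↔ t p := by
        rw [hl]
        exact ⟨fun hx => (hx.resolve_left (not_mem_layer le_rfl)).2, fun hx => Or.inr ⟨le_rfl, hx⟩⟩
      simp only [this]
  · intro v
    fin_cases v
    · simpa using hct.symm.le
    · have : ∑ p, (if ¬ t p then c p else 0) + ∑ p, (if t p then c p else 0) = ∑ p, c p := by
        rw [← Finset.sum_add_distrib]
        exact Finset.sum_congr rfl fun p _ => by split_ifs <;> simp
      simp only [Fin.mk_one, Fin.isValue, one_ne_zero, if_false]
      linarith

/-! ### Lower bound for a cone -/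

open Classical in
/-- If the weights `u` are at least `1` on the non-isolated members of `p` (where `0` counts as
non-isolated) and at least `1 / (s + 1)` on the members and their predecessors, then `u`
dominates the indicator of `p` after averaging with geometric weights. -/
theorem sum_indicator_le_sum_mul {s : ℝ} (hs : 0 ≤ s) (N : ℕ) (p : ℕ → Prop) (hp : ¬ p (N + 1))
    (u : ℕ → ℝ) (hu : ∀ l, 0 ≤ u l)
    (hone : ∀ l, p l → (l = 0 ∨ p (l - 1) ∨ p (l + 1)) → 1 ≤ u l)
    (hfrac : ∀ l, p l ∨ p (l + 1) → 1 ≤ (s + 1) * u l) :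
    ∑ l ∈ Finset.range (N + 1), (if p l then s ^ (N - l) else 0) ≤
      ∑ l ∈ Finset.range (N + 1), s ^ (N - l) * u l := by
  -- After scaling by `s + 1`, an isolated member `l` has deficit at most `s`, while its
  -- predecessor, a non-member, has surplus at least 1. The weight of `l - 1` is `s` times that of
  -- `l`, so the two cancel and the corrections telescope.
  let iso : ℕ → ℝ := fun l => if p l ∧ l ≠ 0 ∧ ¬ p (l - 1) ∧ ¬ p (l + 1) then 1 else 0
  have key : ∀ l, (s + 1) * (if p l then 1 else 0) + (iso (l + 1) - s * iso l) ≤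
      (s + 1) * u l := by
    intro l
    have h0 := mul_nonneg (by linarith : 0 ≤ s + 1) (hu l)
    by_cases hl : p l
    · have h1 : iso (l + 1) = 0 := by simp [iso, hl]
      by_cases hl' : l = 0 ∨ p (l - 1) ∨ p (l + 1)
      · have h2 : iso l = 0 := by
          simp only [iso]; rw [if_neg]; tauto
        have := mul_le_mul_of_nonneg_left (hone l hl hl') (by linarith : 0 ≤ s + 1)
        simp only [h1, h2, hl, if_true]
        linarith
      · have h2 : iso l = 1 := by
          simp only [iso]; rw [if_pos]; tauto
        have := hfrac l (Or.inl hl)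
        simp only [h1, h2, hl, if_true]
        linarith
    · have h1 : iso l = 0 := by simp [iso, hl]
      by_cases hl' : p (l + 1)
      · have h2 : iso (l + 1) ≤ 1 := by simp only [iso]; split_ifs <;> norm_num
        have := hfrac l (Or.inr hl')
        simp only [h1, hl, if_false]
        linarith
      · have h2 : iso (l + 1) = 0 := by simp [iso, hl']
        simp only [h1, h2, hl, if_false]
        linarith
  have htel : ∑ l ∈ Finset.range (N + 1), s ^ (N - l) * (iso (l + 1) - s * iso l) = 0 := by
    have : ∀ l ∈ Finset.range (N + 1), s ^ (N - l) * (iso (l + 1) - s * iso l) =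
        s ^ (N + 1 - (l + 1)) * iso (l + 1) - s ^ (N + 1 - l) * iso l := by
      intro l hl
      have hl : l ≤ N := Nat.lt_succ_iff.1 (Finset.mem_range.1 hl)
      rw [Nat.add_sub_add_right, Nat.sub_add_comm hl, pow_succ]
      ring
    rw [Finset.sum_congr rfl this, Finset.sum_range_sub fun l => s ^ (N + 1 - l) * iso l]
    simp [iso, hp]
  have hsum := Finset.sum_le_sum fun l (_ : l ∈ Finset.range (N + 1)) =>
    mul_le_mul_of_nonneg_left (key l) (pow_nonneg hs (N - l))
  simp only [mul_add (s ^ _) ((s + 1) * _), Finset.sum_add_distrib, htel, add_zero] at hsum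
  refine le_of_mul_le_mul_left ?_ (by linarith : 0 < s + 1)
  rw [Finset.mul_sum, Finset.mul_sum]
  convert hsum using 2 with l _ l _
  · split_ifs <;> ring
  · ring

/-- The independent set of `G` obtained from an independent set `J` of a cone at level `l`, using
an independent set `I` of `G`. -/
def levelSet {V : Type*} {n : ℕ} (J : Set (ConeVertex V n)) (I : Set V) (l : ℕ) : Set V :=
  {x | (x ∈ layer J l ∧ (l = 0 ∨ x ∈ layer J (l - 1) ∨ x ∈ layer J (l + 1))) ∨
    (x ∈ I ∧ (x ∈ layer J l ∨ x ∈ layer J (l + 1)))}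

/-- A vertex taken without regard to `I` lies in layer `l` and also in an adjacent layer, or else `l
= 0`. Hence it has no neighbour in layers `l` and `l + 1`. Any remaining edge would lie inside `I`.
-/
theorem isIndepSet_levelSet {V : Type*} {G : SimpleGraph V} {n : ℕ}
    {J : Set (ConeVertex V n)} (hJ : (cone G n).IsIndepSet J) {I : Set V} (hI : G.IsIndepSet I) (l : ℕ) :
    G.IsIndepSet (levelSet J I l) := by
  have main : ∀ {x y : V}, x ∈ layer J l →
      (l = 0 ∨ x ∈ layer J (l - 1) ∨ x ∈ layer J (l + 1)) →
      (y ∈ layer J l ∨ y ∈ layer J (l + 1)) → ¬ G.Adj x y := by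
    rintro x y hx hx' (hy | hy) hxy
    · rcases Nat.eq_zero_or_pos l with rfl | hl
      · exact not_adj_of_mem_layer_zero hJ hx hy hxy
      · rcases hx' with h | h | h
        · omega
        · exact not_adj_of_mem_layer_succ hJ h (by rwa [Nat.sub_add_cancel hl]) hxy
        · exact not_adj_of_mem_layer_succ hJ hy h hxy.symm
    · exact not_adj_of_mem_layer_succ hJ hx hy hxy
  rintro x (⟨hx, hx'⟩ | ⟨hx, hx'⟩) y (⟨hy, hy'⟩ | ⟨hy, hy'⟩) hne hxy
  · exact main hx hx' (Or.inl hy) hxy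
  · exact main hx hx' hy' hxy
  · exact main hy hy' hx' hxy.symm
  · exact hI hx hy hne hxy

/-- The level sets of an optimal cover of the cone, averaged over an optimal cover of `G` and
geometrically over levels, cover `G`. A set containing the apex has an empty top level set, whose
weight is saved; the apex is covered at least once, so the saving is at least 1/σ. -/
theorem fracChromatic_add_inv_le_cone {V : Type*} [Fintype V] (G : SimpleGraph V) {s : ℝ}
    (hs : 0 ≤ s) (hG : fracChromatic G = s + 1) (N : ℕ) :
    fracChromatic G + (∑ l ∈ Finset.range (N + 1), s ^ l)⁻¹ ≤ fracChromatic (cone G (N + 1)) := by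
  classical
  obtain ⟨ι, _, K, f, hK, hf, hfw, hfcov⟩ := exists_optimal_cover (cone G (N + 1))
  obtain ⟨κ, _, L, φ, hL, hφ, hφw, hφcov⟩ := exists_optimal_cover G
  have ha : 0 < s + 1 := by linarith
  set σ : ℝ := ∑ l ∈ Finset.range (N + 1), s ^ l with hσ
  have hσpos : 0 < σ := by
    rw [hσ, Finset.sum_range_succ']
    have := Finset.sum_nonneg fun i (_ : i ∈ Finset.range N) => pow_nonneg hs (i + 1)
    simp; linarith
  have hσ' : ∑ l ∈ Finset.range (N + 1), s ^ (N - l) = σ := by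
    have := Finset.sum_range_reflect (fun l => s ^ l) (N + 1)
    simpa using this
  let e : ι → ℕ → ℝ := fun J l =>
    if l = N ∧ none ∈ K J then 0 else s ^ (N - l)
  have he : ∀ J l, 0 ≤ e J l := fun J l => by
    simp only [e]; split_ifs
    · exact le_rfl
    · exact pow_nonneg hs _
  have hesum : ∀ J, ∑ l ∈ Finset.range (N + 1), e J l = σ - if none ∈ K J then 1 else 0 := by
    intro J
    rw [← hσ', Finset.sum_range_succ, Finset.sum_range_succ]
    have : ∀ l ∈ Finset.range N, e J l = s ^ (N - l) := fun l hl => by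
      have := (Finset.mem_range.1 hl).ne
      simp [e, this]
    rw [Finset.sum_congr rfl this]
    simp only [e, true_and, Nat.sub_self, pow_zero]
    split_ifs <;> ring
  -- The divisor `s + 1` is the total weight of `φ`, and `σ` that of the powers of `s`.
  let c : ι × κ × Fin (N + 1) → ℝ := fun t =>
    f t.1 * φ t.2.1 * e t.1 t.2.2 / ((s + 1) * σ)
  have hmain : fracChromatic G ≤ ∑ t, c t := by
    refine fracChromatic_le_of_cover G (fun t => levelSet (K t.1) (L t.2.1) t.2.2)
      (fun t => isIndepSet_levelSet (hK t.1) (hL t.2.1) _) c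
      (fun t => div_nonneg (mul_nonneg (mul_nonneg (hf _) (hφ _)) (he _ _))
        (mul_nonneg ha.le hσpos.le)) fun x => ?_
    let u : ι → ℕ → ℝ := fun J l =>
      (∑ I, if x ∈ levelSet (K J) (L I) l then φ I else 0) / (s + 1)
    have hu : ∀ J l, 0 ≤ u J l := fun J l =>
      div_nonneg (Finset.sum_nonneg fun I _ => by split_ifs <;> simp [hφ]) ha.le
    have hJ : ∀ J, f J / σ * ∑ l ∈ Finset.range (N + 1),
          (if x ∈ layer (K J) l then s ^ (N - l) else 0) ≤
        ∑ q : κ × Fin (N + 1),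
          if x ∈ levelSet (K J) (L q.1) q.2 then c (J, q) else 0 := by
      intro J
      refine (mul_le_mul_of_nonneg_left (sum_indicator_le_sum_mul hs N (fun l => x ∈ layer (K J) l)
        (not_mem_layer le_rfl) (u J) (hu J) ?_ ?_) (div_nonneg (hf J) hσpos.le)).trans_eq ?_
      · intro l hl hl'
        have : ∀ I : κ, x ∈ levelSet (K J) (L I) l :=
          fun I => Or.inl ⟨hl, hl'⟩
        simp [u, this, hφw, hG, ha.ne']
      · intro l hl
        simp only [u]
        rw [mul_div_cancel₀ _ ha.ne']
        refine (hφcov x).trans (Finset.sum_le_sum fun I _ => ?_)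
        by_cases hI : x ∈ L I
        · have : x ∈ levelSet (K J) (L I) l := Or.inr ⟨hI, hl⟩
          simp [hI, this]
        · simp only [hI, if_false]
          split_ifs <;> simp [hφ]
      · rw [Fintype.sum_prod_type_right, Finset.mul_sum, Finset.sum_range]
        refine Finset.sum_congr rfl fun l _ => ?_
        simp only [u]
        rw [Finset.sum_div, Finset.mul_sum, Finset.mul_sum]
        refine Finset.sum_congr rfl fun I _ => ?_
        by_cases hx : x ∈ levelSet (K J) (L I) l
        · have : e J l = s ^ (N - (l : ℕ)) := by
            simp only [e]
            rw [if_neg]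
            rintro ⟨hl, hJ⟩
            have h1 : x ∉ layer (K J) l := not_mem_layer_of_apex_mem (hK J) hJ (by omega)
            have h2 : x ∉ layer (K J) (l + 1) := not_mem_layer (by omega)
            rcases hx with hx | hx <;> tauto
          simp only [hx, if_true, c, this]
          field_simp
        · simp [hx]
    rw [Fintype.sum_prod_type]
    refine le_trans ?_ (Finset.sum_le_sum fun J _ => hJ J)
    have hswap : ∑ J, f J / σ * ∑ l ∈ Finset.range (N + 1),
          (if x ∈ layer (K J) l then s ^ (N - l) else 0) =
        ∑ l ∈ Finset.range (N + 1), s ^ (N - l) / σ *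
          ∑ J, if x ∈ layer (K J) l then f J else 0 := by
      simp only [Finset.mul_sum]
      rw [Finset.sum_comm]
      refine Finset.sum_congr rfl fun l _ => Finset.sum_congr rfl fun J _ => ?_
      split_ifs
      · ring
      · ring
    rw [hswap]
    calc (1 : ℝ) = ∑ l ∈ Finset.range (N + 1), s ^ (N - l) / σ := by
          rw [← Finset.sum_div, hσ', div_self hσpos.ne']
      _ ≤ _ := Finset.sum_le_sum fun l hl => by
          refine le_mul_of_one_le_right (div_nonneg (pow_nonneg hs _) hσpos.le) ?_
          simp only [mem_layer_iff (Finset.mem_range.1 hl)]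
          exact hfcov _
  have htotal : ∑ t, c t = ∑ J, f J * (1 - (if none ∈ K J then 1 else 0) / σ) := by
    rw [Fintype.sum_prod_type]
    refine Finset.sum_congr rfl fun J _ => ?_
    have : ∑ q, c (J, q) = f J * (∑ I, φ I) * (∑ l : Fin (N + 1), e J l) / ((s + 1) * σ) := by
      rw [Fintype.sum_prod_type, Finset.mul_sum (f := φ), Finset.sum_mul, Finset.sum_div]
      refine Finset.sum_congr rfl fun I _ => ?_
      rw [Finset.mul_sum, Finset.sum_div]
    rw [this, hφw, hG, ← Finset.sum_range (e J), hesum]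
    field_simp
  have hstar : 1 ≤ ∑ J, if none ∈ K J then f J else 0 := hfcov none
  have hsplit : ∑ J, f J * (1 - (if none ∈ K J then 1 else 0) / σ) =
      fracChromatic (cone G (N + 1)) -
        (∑ J, if none ∈ K J then f J else 0) * σ⁻¹ := by
    rw [← hfw, Finset.sum_mul, ← Finset.sum_sub_distrib]
    refine Finset.sum_congr rfl fun J _ => ?_
    split_ifs <;> ring
  have := mul_le_mul_of_nonneg_right hstar (inv_nonneg.2 hσpos.le)
  linarith

/-! ### Upper bound for two arms of equal even height -/

/-- Layer `i` of the independent sets of the cones used in the optimal colouring: a copy of `I`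
below level `k`, then alternately empty and full layers. -/
def patternLayer {V : Type*} (I : Set V) (k i : ℕ) : Set V :=
  {x | (i < k ∧ x ∈ I) ∨ (k < i ∧ Odd (i + k))}

theorem not_adj_of_mem_patternLayer_succ {V : Type*} {G : SimpleGraph V} {I : Set V}
    (hI : G.IsIndepSet I) {k i : ℕ} {x y : V} (hx : x ∈ patternLayer I k i)
    (hy : y ∈ patternLayer I k (i + 1)) : ¬ G.Adj x y := by
  rcases hx with ⟨h1, hx⟩ | ⟨h1, hx⟩ <;> rcases hy with ⟨h2, hy⟩ | ⟨h2, hy⟩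
  · exact fun hxy => hI hx hy hxy.ne hxy
  · omega
  · omega
  · rw [Nat.odd_iff] at hx hy
    omega

theorem sum_range_two_mul_pow (s : ℝ) (M : ℕ) :
    ∑ l ∈ Finset.range (2 * M), s ^ l = ∑ j ∈ Finset.range M, s ^ (2 * j) * (s + 1) := by
  induction M with
  | zero => simp
  | succ M ih =>
    rw [Nat.mul_succ, Finset.sum_range_succ, Finset.sum_range_succ, ih,
      Finset.sum_range_succ]
    ring

/-- Here `γ j` and `δ j` stand for the coverage of a vertex in layer `i` by the sets of levels `2j +
1` and `2j + 2`. For even `i` the bound holds term by term. For `i = 2r + 1` the term `j = r` may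
lack `s^(2r)`; the terms `j < r` have surplus `s^(2j) (s² - 1)`, which telescopes to `s^(2r) - 1`,
and the level-0 set supplies the missing 1. -/
theorem sum_le_of_alternating_cover {s : ℝ} (hs : 0 ≤ s) (M i : ℕ) (γ δ : ℕ → ℝ)
    (hγ : ∀ j, 0 ≤ γ j) (hδ : ∀ j, 0 ≤ δ j)
    (hγ1 : ∀ j, i < 2 * j + 1 → 1 ≤ γ j) (hδ1 : ∀ j, i < 2 * j + 2 → 1 ≤ δ j)
    (hγ2 : ∀ j, 2 * j + 1 < i → Even i → s + 1 ≤ γ j)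
    (hδ2 : ∀ j, 2 * j + 2 < i → Odd i → s + 1 ≤ δ j) :
    ∑ l ∈ Finset.range (2 * M), s ^ l ≤
      (if Odd i then 1 else 0) + ∑ j ∈ Finset.range M, s ^ (2 * j) * (γ j + s * δ j) := by
  rw [sum_range_two_mul_pow]
  rcases Nat.even_or_odd i with hi | hi
  · rw [if_neg (Nat.not_odd_iff_even.2 hi), zero_add]
    refine Finset.sum_le_sum fun j _ => mul_le_mul_of_nonneg_left ?_ (pow_nonneg hs _)
    rw [Nat.even_iff] at hi
    rcases lt_or_ge i (2 * j + 1) with h | h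
    · have := mul_le_mul_of_nonneg_left (hδ1 j (by omega)) hs
      linarith [hγ1 j h]
    · have := mul_nonneg hs (hδ j)
      linarith [hγ2 j (by omega) (Nat.even_iff.2 hi)]
  · rw [if_pos hi]
    obtain ⟨r, rfl⟩ := hi
    let g : ℕ → ℝ := fun j => if j ≤ r then s ^ (2 * j) else 0
    have hg : ∀ j, 0 ≤ g j := fun j => by
      simp only [g]; split_ifs
      · exact pow_nonneg hs _
      · exact le_rfl
    have key : ∀ j ∈ Finset.range M,
        s ^ (2 * j) * (s + 1) + (g (j + 1) - g j) ≤ s ^ (2 * j) * (γ j + s * δ j) := by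
      intro j _
      have hp := pow_nonneg hs (2 * j)
      rcases lt_trichotomy j r with h | h | h
      · have h1 : g (j + 1) = s ^ (2 * j) * (s * s) := by
          simp only [g]; rw [if_pos (by omega)]; ring
        have h2 : g j = s ^ (2 * j) := by simp only [g]; rw [if_pos h.le]
        have h3 := mul_le_mul_of_nonneg_left (hδ2 j (by omega) ⟨r, rfl⟩) hs
        rw [h1, h2]
        have : s ^ (2 * j) * (s * (s + 1)) ≤ s ^ (2 * j) * (γ j + s * δ j) :=
          mul_le_mul_of_nonneg_left (by linarith [hγ j]) hp
        linarith
      · have h1 : g (j + 1) = 0 := by simp only [g]; rw [if_neg (by omega)]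
        have h2 : g j = s ^ (2 * j) := by simp only [g]; rw [if_pos h.le]
        have h3 := mul_le_mul_of_nonneg_left (hδ1 j (by omega)) hs
        rw [h1, h2]
        have : s ^ (2 * j) * s ≤ s ^ (2 * j) * (γ j + s * δ j) :=
          mul_le_mul_of_nonneg_left (by linarith [hγ j]) hp
        linarith
      · have h1 : g (j + 1) = 0 := by simp only [g]; rw [if_neg (by omega)]
        have h2 : g j = 0 := by simp only [g]; rw [if_neg (by omega)]
        have h3 := mul_le_mul_of_nonneg_left (hδ1 j (by omega)) hs
        rw [h1, h2, sub_zero, add_zero]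
        exact mul_le_mul_of_nonneg_left (by linarith [hγ1 j (by omega)]) hp
    have hsum := Finset.sum_le_sum key
    rw [Finset.sum_add_distrib, Finset.sum_range_sub] at hsum
    have h0 : g 0 = 1 := by simp [g]
    linarith [hg M]

/-- The levels used on the two sides of the double cone. -/
def patternLevel {α : Type*} {M : ℕ} : Option (α × Fin M × Fin 3) → Fin 2 → ℕ
  | none, _ => 0
  | some (_, j, r), v => if r.val = v.val then 2 * j + 1 else 2 * j + 2

theorem fracChromatic_hCone_le_add_inv {V : Type*} [Fintype V] (G : SimpleGraph V)
    (H : SimpleGraph (Fin 2)) {s : ℝ} (hs : 1 ≤ s) (hG : fracChromatic G = s + 1) {M : ℕ}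
    (hM : 0 < M) (h : Fin 2 → ℕ) (hh : ∀ v, h v = 2 * M) :
    fracChromatic (hCone G H h) ≤
      fracChromatic G + (∑ l ∈ Finset.range (2 * M), s ^ l)⁻¹ := by
  classical
  obtain ⟨ι, _, K, φ, hK, hφ, hφw, hφcov⟩ := exists_optimal_cover G
  have hs0 : 0 ≤ s := by linarith
  have ha : 0 < s + 1 := by linarith
  set σ : ℝ := ∑ l ∈ Finset.range (2 * M), s ^ l with hσ
  have hσpos : 0 < σ :=
    Finset.sum_pos (fun l _ => pow_pos (by linarith) l) (Finset.nonempty_range_iff.2 (by omega))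
  have hσ2 : ∑ j : Fin M, s ^ (2 * (j : ℕ)) / σ * (s + 1) = 1 := by
    rw [← Finset.sum_range fun j => s ^ (2 * j) / σ * (s + 1)]
    simp only [div_mul_eq_mul_div]
    rw [← Finset.sum_div, ← sum_range_two_mul_pow, ← hσ, div_self hσpos.ne']
  let base : Option (ι × Fin M × Fin 3) → Set V := fun t =>
    match t with
    | none => ∅
    | some (I, _, _) => K I
  have hbase : ∀ t, G.IsIndepSet (base t) := by
    rintro (_ | ⟨I, _, _⟩)
    · simp [base]
    · exact hK I
  -- On each arm, level `2j + 1` comes from one value of `r`, with factor 1, and level `2j + 2` from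
  -- the other two, with factor 1 + (s - 1) = s. So level `k ≥ 1` has weight proportional to
  -- `s^(k-1)`, yet the two arms never have odd levels simultaneously. Nonnegativity of `s - 1` is
  -- where χ_f(G) ≥ 2 enters.
  let c : Option (ι × Fin M × Fin 3) → ℝ := fun t =>
    match t with
    | none => σ⁻¹
    | some (I, j, r) => φ I * (s ^ (2 * (j : ℕ)) / σ) * (if r.val = 2 then s - 1 else 1)
  have hlevel : ∀ (t : Option (ι × Fin M × Fin 3)) v, patternLevel t v ≤ 2 * M := by
    rintro (_ | ⟨I, j, r⟩) v
    · simp [patternLevel]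
    · simp only [patternLevel]
      split_ifs <;> omega
  have hsum : ∑ t, c t = fracChromatic G + σ⁻¹ := by
    rw [Fintype.sum_option, Fintype.sum_prod_type, add_comm, ← hφw]
    congr 1
    refine Finset.sum_congr rfl fun I _ => ?_
    calc _ = φ I * ∑ j : Fin M, s ^ (2 * (j : ℕ)) / σ * (s + 1) := by
          rw [Fintype.sum_prod_type, Finset.mul_sum]
          refine Finset.sum_congr rfl fun j _ => ?_
          simp only [Fin.sum_univ_three, c]
          norm_num
          ring
      _ = φ I := by rw [hσ2, mul_one]
  rw [← hsum]
  refine fracChromatic_hCone_le G H (fun v => by rw [hh]; omega)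
    (fun t => patternLayer (base t) (patternLevel t 0) 0)
    (fun t v i => patternLayer (base t) (patternLevel t v) i)
    (fun t v => Odd (patternLevel t v)) c ?_ ?_ ?_ ?_ ?_ ?_ ?_ ?_
  · rintro (_ | ⟨I, j, r⟩)
    · exact inv_nonneg.2 hσpos.le
    · refine mul_nonneg (mul_nonneg (hφ I) (div_nonneg (pow_nonneg hs0 _) hσpos.le)) ?_
      split_ifs <;> linarith
  · rintro (_ | ⟨I, j, r⟩) v
    · rfl
    · have hpos : ∀ v, 0 < patternLevel (some (I, j, r)) v := fun v => by
        simp only [patternLevel]; split_ifs <;> omega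
      ext x
      simp [patternLayer, hpos]
  · rintro t x (⟨-, hx⟩ | ⟨hx, -⟩) y (⟨-, hy⟩ | ⟨hy, -⟩)
    · exact fun hxy => hbase t hx hy hxy.ne hxy
    · omega
    · omega
    · omega
  · intro t v i _ x hx y hy
    exact not_adj_of_mem_patternLayer_succ (hbase t) hx hy
  -- An odd level is at most `2M - 1`, the index of the top layer. That layer has the same parity as
  -- the level, hence is empty.
  · intro t v hT i hi x hx
    have hl := hlevel t v
    rw [hh] at hi
    simp only [Nat.odd_iff] at hT
    rcases hx with ⟨hx, -⟩ | ⟨hx, hodd⟩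
    · omega
    · rw [Nat.odd_iff] at hodd
      omega
  · rintro (_ | ⟨I, j, r⟩) v v' hv hT hT'
    · simp [patternLevel] at hT
    · have hne : v.val ≠ v'.val := fun h => hv.ne (Fin.ext h)
      simp only [patternLevel, Nat.odd_iff] at hT hT'
      split_ifs at hT hT' <;> omega
  · intro v i x hi
    let κ : ℕ → ℝ := fun k =>
      ∑ I, if x ∈ patternLayer (K I) k i then φ I else 0
    have hκ : ∀ k, 0 ≤ κ k := fun k =>
      Finset.sum_nonneg fun I _ => by split_ifs <;> simp [hφ]
    have hκ1 : ∀ k, i < k → 1 ≤ κ k := fun k hk => by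
      refine (hφcov x).trans_eq (Finset.sum_congr rfl fun I _ => ?_)
      have : x ∈ patternLayer (K I) k i ↔ x ∈ K I :=
        ⟨fun hx => (hx.resolve_right fun h => by omega).2, fun hx => Or.inl ⟨hk, hx⟩⟩
      simp only [this]
    have hκ2 : ∀ k, k < i → Odd (i + k) → s + 1 ≤ κ k := fun k hk hodd => by
      have : ∀ I : ι, x ∈ patternLayer (K I) k i :=
        fun I => Or.inr ⟨hk, hodd⟩
      simp only [κ, this, if_true, hφw, hG, le_refl]
    have hcover := sum_le_of_alternating_cover hs0 M i (fun j => κ (2 * j + 1))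
      (fun j => κ (2 * j + 2)) (fun j => hκ _) (fun j => hκ _) (fun j hj => hκ1 _ hj)
      (fun j hj => hκ1 _ hj)
      (fun j hj hi => hκ2 _ hj (by rw [Nat.even_iff] at hi; rw [Nat.odd_iff]; omega))
      (fun j hj hi => hκ2 _ hj (by rw [Nat.odd_iff] at hi ⊢; omega))
    rw [← hσ] at hcover
    have hsome : ∑ q : ι × Fin M × Fin 3,
        (if x ∈ patternLayer (base (some q)) (patternLevel (some q) v) i then c (some q) else 0) =
        (∑ j ∈ Finset.range M, s ^ (2 * j) * (κ (2 * j + 1) + s * κ (2 * j + 2))) / σ := by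
      rw [Fintype.sum_prod_type_right, Fintype.sum_prod_type, Finset.sum_div, Finset.sum_range]
      refine Finset.sum_congr rfl fun j _ => ?_
      simp only [κ]
      rw [Fin.sum_univ_three, ← Finset.sum_add_distrib, ← Finset.sum_add_distrib, Finset.mul_sum,
        ← Finset.sum_add_distrib, Finset.mul_sum, Finset.sum_div]
      refine Finset.sum_congr rfl fun I _ => ?_
      fin_cases v
      · simp [patternLevel, base, c]
        split_ifs <;> ring
      · simp [patternLevel, base, c]
        split_ifs <;> ring
    rw [Fintype.sum_option, hsome]
    have hnone : (if x ∈ patternLayer (base none) (patternLevel (none : Option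
        (ι × Fin M × Fin 3)) v) i then c none else 0) =
        (if Odd i then 1 else 0) / σ := by
      have : x ∈ patternLayer (base none) (patternLevel (none : Option
          (ι × Fin M × Fin 3)) v) i ↔ Odd i := by
        simp only [patternLayer, patternLevel, base, Set.mem_ofPred_eq, add_zero]
        refine ⟨fun hx => (hx.resolve_left fun h => by omega).2, fun hx => Or.inr ⟨hx.pos, hx⟩⟩
      simp only [this, c]
      split_ifs <;> simp
    rw [hnone, ← add_div, one_le_div hσpos]
    exact hcover
  · intro v
    rw [Fintype.sum_option]
    have hnone : ¬ Odd (patternLevel (none : Option (ι × Fin M × Fin 3)) v) := by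
      simp [patternLevel]
    rw [if_neg hnone, zero_add, Fintype.sum_prod_type]
    -- Exactly one `r` gives arm `v` an odd level, so its apex has coverage (s + 1) Σ s^(2j) / σ =
    -- 1.
    have htotal : 1 = ∑ I, φ I * ∑ j : Fin M, s ^ (2 * (j : ℕ)) / σ := by
      rw [← Finset.sum_mul, hφw, hG, mul_comm, Finset.sum_mul, hσ2]
    refine htotal.trans_le (Finset.sum_le_sum fun I _ => ge_of_eq ?_)
    rw [Fintype.sum_prod_type, Finset.mul_sum]
    refine Finset.sum_congr rfl fun j _ => ?_
    rw [Fin.sum_univ_three]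
    have h1 : Odd (2 * (j : ℕ) + 1) := ⟨j, rfl⟩
    have h2 : ¬ Odd (2 * (j : ℕ) + 2) := by rw [Nat.odd_iff]; omega
    fin_cases v
    · simp [patternLevel, c, h1, h2]
    · simp [patternLevel, c, h1, h2]

end GeneralizedCone

theorem theorem9 {V : Type*} [Fintype V] (G : SimpleGraph V) (hG : ∃ x y : V, G.Adj x y)
    (n : ℕ) (hn : 1 ≤ n) (h : Fin 2 → ℕ) (h_first : h 0 = n) (h_second : n ≤ h 1)
    (h_const : h 1 = n → Even n) :
    GeneralizedCone.fracChromatic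
        (GeneralizedCone.hCone G (SimpleGraph.completeGraph (Fin 2)) h) =
      GeneralizedCone.fracChromatic (GeneralizedCone.cone G n) := by
  open GeneralizedCone in
  refine le_antisymm ?_ ?_
  · rcases h_second.eq_or_lt with heq | hlt
    · obtain ⟨M, hM⟩ := (h_const heq.symm).two_dvd
      obtain ⟨x, y, hxy⟩ := hG
      have htwo := two_le_fracChromatic hxy
      have hchi : fracChromatic G = (fracChromatic G - 1) + 1 := by ring
      have hupper := fracChromatic_hCone_le_add_inv G (SimpleGraph.completeGraph (Fin 2))
        (by linarith) hchi (M := M) (by omega) h (fun v => by fin_cases v <;> simp <;> omega)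
      have hlower := fracChromatic_add_inv_le_cone G (by linarith) hchi (n - 1)
      rw [Nat.sub_add_cancel hn] at hlower
      rw [← hM] at hupper
      exact hupper.trans hlower
    · exact fracChromatic_hCone_le_cone_of_lt G hG _ hn h h_first hlt
  · subst h_first
    exact fracChromatic_le_of_hom (glueHom G _ h 0)
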